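/- Let $a<T$ be real numbers and let $(J_a^\alpha)_{\alpha>0}$ be a family of continuous linear operators on the real Banach space $L^1(a,T)$. Suppose: 1. (Identity) for every $f\in L^1(a,T)$, $J_a^1f(x)=\int_a^x f(t)\,dt$ for almost every $x\in(a,T)$; 2. (Index law) $J_a^{\alpha+\beta}=J_a^\alpha\circ J_a^\beta$ for all $\alpha,\beta>0$; 3. (Continuity) the map $\alpha\mapsto J_a^\alpha 1$ from $(0,\infty)$ to $L^1(a,T)$ with its norm is continuous at at least one point $\alpha_0\in(0,\infty)$. Then $J_a^\alpha$ is the Riemann–Liouville integral of order $\alpha$ with origin $a$ for every $\alpha>0$: for every $f\in L^1(a,T)$ and almost every $x\in(a,T)$, the function $t\mapsto (x-t)^{\alpha-1}f(t)$ is integrable on $(a,x)$ and $$J_a^\alpha f(x)=\frac1{\Gamma(\alpha)}\int_a^x (x-t)^{\alpha-1}f(t)\,dt .$$ The case $a=0$, $0<T<\infty$ is the statement on $L^1(0,T)$. Moreover, condition 3 is weaker than (that is, implied by) the condition of Cartwright and McMullen that $\alpha\mapsto J_a^\alpha$ be continuous from $(0,\infty)$ into the bounded linear operators on $L^1(a,T)$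 with the operator norm. -/

import Mathlib

open MeasureTheory Set

/-- The real Banach space `L¹(a, T)`. -/
abbrev L1On (a T : ℝ) : Type := Lp ℝ 1 (volume.restrict (Ioo a T))

/-- The constant function `1`, as an element of `L¹(a, T)`. -/
noncomputable def oneL1 (a T : ℝ) : L1On a T := Lp.const 1 (volume.restrict (Ioo a T)) (1 : ℝ)

/-- The integrand `t ↦ (x - t)^(α - 1) f(t)` of the Riemann–Liouville integral at the point `x`. -/
noncomputable def rlIntegrand (α : ℝ) (f : ℝ → ℝ) (x : ℝ) : ℝ → ℝ :=
  fun t => (x - t) ^ (α - 1) * f t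

/-- The Riemann–Liouville integral of order `α` with left origin `a`:
`(1 / Γ(α)) ∫ₐˣ (x - t)^(α - 1) f(t) dt`. -/
noncomputable def rlIntegral (a α : ℝ) (f : ℝ → ℝ) (x : ℝ) : ℝ :=
  (1 / Real.Gamma α) * ∫ t in a..x, rlIntegrand α f x t

/-- The operator `A` on `L¹(a, T)` is the Riemann–Liouville integral of order `α` with origin `a`:
for every `f`, for almost every `x ∈ (a, T)`, the integral defining `I_a^α f(x)` converges
absolutely and `A f (x) = I_a^α f(x)`. -/
def IsRiemannLiouville (a T α : ℝ) (A : L1On a T →L[ℝ] L1On a T) : Prop :=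
  ∀ f : L1On a T, ∀ᵐ x ∂(volume.restrict (Ioo a T)),
    IntervalIntegrable (rlIntegrand α f x) volume a x ∧ A f x = rlIntegral a α f x

open MeasureTheory Set

open Filter Topology Asymptotics

/-! Laplace transforms over `(a, T)` are compared modulo functions that are `O(exp (-r s))` for
every `r < T - a`. Nothing is lost: a function with negligible transform is zero
(`ae_eq_zero_of_expNegligible_laplaceOn`). In this calculus the Riemann–Liouville integral of order
`α` multiplies transforms by `s^(-α)` (`abs_laplaceOn_rlIntegral_sub_le`), and any operator `A`
commuting with integration multiplies them by `s` times the transform of `A 1`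
(`expNegligible_laplaceOn_commutant`).

By the index law every `J α` commutes with `J 1`, so it is determined by `X_α(s) = s^(α+1) L(J α
1)(s)`, and the goal is `X_α ≈ 1`. The index law gives `X_{α+β} ≈ X_α X_β`, and `X_1 ≈ 1`. For
rational `q` some positive power of `X_q` is therefore `≈ 1`, while `X_q ≈ X_{q/2}²` rules out
negative roots, so `X_q ≈ 1`. Continuity of `α ↦ J α 1` at `α₀` spreads to all larger orders, where
rational approximation applies because the Riemann–Liouville error bound is uniform in the order.
Smaller orders follow by cancelling in `X_{α+β} ≈ X_α X_β` for large `β`. -/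

/-- The Laplace transform, based at `a`, of the restriction of `f` to `(a, T)`. -/
noncomputable def laplaceOn (a T s : ℝ) (f : ℝ → ℝ) : ℝ :=
  ∫ x in Ioo a T, Real.exp (-(s * (x - a))) * f x

/-- A function which is `O(exp (-r s))` at infinity for every `r < L`. -/
def ExpNegligible (L : ℝ) (F : ℝ → ℝ) : Prop :=
  ∀ r < L, F =O[atTop] fun s => Real.exp (-(r * s))

/-! ### Calculus of exponentially negligible functions. -/

namespace ExpNegligible

variable {L : ℝ} {F G : ℝ → ℝ}

theorem add (hF : ExpNegligible L F) (hG : ExpNegligible L G) :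
    ExpNegligible L (fun s => F s + G s) := fun r hr => (hF r hr).add (hG r hr)

theorem sub (hF : ExpNegligible L F) (hG : ExpNegligible L G) :
    ExpNegligible L (fun s => F s - G s) := fun r hr => (hF r hr).sub (hG r hr)

theorem congr' (hF : ExpNegligible L F) (h : F =ᶠ[atTop] G) : ExpNegligible L G :=
  fun r hr => (hF r hr).congr' h EventuallyEq.rfl

theorem of_isBigO (hF : ExpNegligible L F) (h : G =O[atTop] F) : ExpNegligible L G :=
  fun r hr => h.trans (hF r hr)

/-- A polynomially bounded factor preserves negligibility. -/
theorem mul_left (hF : ExpNegligible L F) (p : ℝ) (hG : G =O[atTop] fun s => s ^ p) :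
    ExpNegligible L (fun s => G s * F s) := by
  intro r hr
  -- Half of the gap `L - r` absorbs the power of `s`.
  have hr' : 0 < (L - r) / 2 := by linarith
  have h := (hG.trans (isLittleO_rpow_exp_pos_mul_atTop p hr').isBigO).mul
    (hF ((r + L) / 2) (by linarith))
  refine h.congr_right fun s => ?_
  rw [← Real.exp_add]
  congr 1
  ring

theorem tendsto_zero (hL : 0 < L) (hF : ExpNegligible L F) : Tendsto F atTop (𝓝 0) := by
  refine (hF (L / 2) (by linarith)).trans_tendsto ?_
  exact Real.tendsto_exp_neg_atTop_nhds_zero.comp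
    (tendsto_id.const_mul_atTop (by positivity : 0 < L / 2))

end ExpNegligible

/-! ### Uniqueness for the truncated Laplace transform. -/

section Laplace

variable {a T : ℝ} {f g : ℝ → ℝ}

theorem integrableOn_exp_mul (hf : IntegrableOn f (Ioo a T)) (s c : ℝ) :
    IntegrableOn (fun x => Real.exp (s * (x - c)) * f x) (Ioo a T) := by
  have h : IntegrableOn f (Icc a T) := (integrableOn_Icc_iff_integrableOn_Ioo (f := f)).mpr hf
  exact (h.continuousOn_mul (by fun_prop) isCompact_Icc).mono_set Ioo_subset_Icc_self

theorem integrableOn_exp_neg_mul (hf : IntegrableOn f (Ioo a T)) (s : ℝ) :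
    IntegrableOn (fun x => Real.exp (-(s * (x - a))) * f x) (Ioo a T) := by
  simpa using integrableOn_exp_mul hf (-s) a

theorem laplaceOn_congr (s : ℝ) (h : f =ᵐ[volume.restrict (Ioo a T)] g) :
    laplaceOn a T s f = laplaceOn a T s g := by
  refine integral_congr_ae ?_
  filter_upwards [h] with x hx
  rw [hx]

theorem laplaceOn_sub (s : ℝ) (hf : IntegrableOn f (Ioo a T)) (hg : IntegrableOn g (Ioo a T)) :
    laplaceOn a T s (fun x => f x - g x) = laplaceOn a T s f - laplaceOn a T s g := by
  rw [laplaceOn, laplaceOn, laplaceOn, ← integral_sub (integrableOn_exp_neg_mul hf s)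
    (integrableOn_exp_neg_mul hg s)]
  congr 1 with x
  ring

theorem abs_laplaceOn_le {s : ℝ} (hs : 0 ≤ s) (hf : IntegrableOn f (Ioo a T)) :
    |laplaceOn a T s f| ≤ ∫ x in Ioo a T, |f x| := by
  refine (abs_integral_le_integral_abs).trans ?_
  refine setIntegral_mono_on (integrableOn_exp_neg_mul hf s).abs hf.abs measurableSet_Ioo ?_
  intro x hx
  rw [abs_mul, Real.abs_exp]
  refine mul_le_of_le_one_left (abs_nonneg _) (Real.exp_le_one_iff.mpr ?_)
  have := mul_nonneg hs (sub_nonneg.mpr hx.1.le)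
  linarith

/-- Termwise integration of the power series of the outer exponential: the integral depends only on
the transform at the multiples of `m`. -/
theorem hasSum_integral_exp_neg_exp (hf : IntegrableOn f (Ioo a T)) (b m : ℝ) :
    HasSum (fun k : ℕ => (-1) ^ k / (k.factorial : ℝ) * Real.exp (k * m * (b - a)) *
        laplaceOn a T (k * m) f)
      (∫ x in Ioo a T, Real.exp (-Real.exp (m * (b - x))) * f x) := by
  have hexp : ∀ y : ℝ, HasSum (fun k : ℕ => y ^ k / (k.factorial : ℝ)) (Real.exp y) := by
    intro y
    rw [Real.exp_eq_exp_ℝ]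
    exact NormedSpace.expSeries_div_hasSum_exp y
  have hint : ∀ k : ℕ, IntegrableOn (fun x => (-Real.exp (m * (b - x))) ^ k /
      (k.factorial : ℝ) * f x) (Ioo a T) := by
    intro k
    have h : IntegrableOn f (Icc a T) := (integrableOn_Icc_iff_integrableOn_Ioo (f := f)).mpr hf
    exact (h.continuousOn_mul (by fun_prop) isCompact_Icc).mono_set Ioo_subset_Icc_self
  have key := hasSum_integral_of_summable_integral_norm (μ := volume.restrict (Ioo a T)) hint ?_
  · have h1 : (∫ x in Ioo a T, ∑' k : ℕ, (-Real.exp (m * (b - x))) ^ k / (k.factorial : ℝ) * f x) =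
        ∫ x in Ioo a T, Real.exp (-Real.exp (m * (b - x))) * f x := by
      congr 1 with x
      rw [tsum_mul_right, (hexp _).tsum_eq]
    rw [h1] at key
    refine key.congr_fun fun k => ?_
    simp only [laplaceOn]
    rw [← integral_const_mul]
    congr 1 with x
    rw [neg_pow (Real.exp _), ← Real.exp_nat_mul, ← mul_assoc, mul_assoc _ (Real.exp _) (Real.exp _),
      ← Real.exp_add]
    have : (k : ℝ) * m * (b - a) + -(k * m * (x - a)) = k * (m * (b - x)) := by ring
    rw [this]
    ring
  · set B := Real.exp (|m| * (|b| + |a| + |T|)) with hB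
    refine Summable.of_nonneg_of_le (fun k => integral_nonneg fun x => norm_nonneg _) (fun k => ?_)
      ((hexp B).summable.mul_right (∫ x in Ioo a T, |f x|))
    rw [← integral_const_mul]
    refine setIntegral_mono_on (hint k).norm (hf.abs.const_mul _) measurableSet_Ioo fun x hx => ?_
    rw [norm_mul, norm_div, norm_pow, norm_neg, Real.norm_eq_abs (Real.exp _), Real.abs_exp,
      Real.norm_natCast, Real.norm_eq_abs]
    gcongr
    rw [hB, Real.exp_le_exp]
    refine (le_abs_self _).trans ?_
    rw [abs_mul]
    gcongr
    have h1 := neg_abs_le a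
    have h2 := le_abs_self T
    have h3 := neg_abs_le b
    have h4 := le_abs_self b
    have h5 := abs_nonneg a
    have h6 := abs_nonneg T
    rw [abs_le]
    constructor <;> linarith [hx.1, hx.2]

/-- The double exponential weight tends to `0` for `x < b` and to `1` for `x > b`. -/
theorem tendsto_integral_exp_neg_exp (hf : IntegrableOn f (Ioo a T)) (b : ℝ) :
    Tendsto (fun n : ℕ => ∫ x in Ioo a T, Real.exp (-Real.exp (n * (b - x))) * f x) atTop
      (𝓝 (∫ x in Ioo a T, (Ioi b).indicator f x)) := by
  refine tendsto_integral_of_dominated_convergence (fun x => |f x|) ?_ hf.abs ?_ ?_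
  · intro n
    exact (Continuous.aestronglyMeasurable (by fun_prop)).mul hf.aestronglyMeasurable
  · intro n
    refine ae_of_all _ fun x => ?_
    rw [norm_mul, Real.norm_eq_abs, Real.abs_exp, Real.norm_eq_abs]
    refine mul_le_of_le_one_left (abs_nonneg _) (Real.exp_le_one_iff.mpr ?_)
    linarith [Real.exp_pos (n * (b - x))]
  · have hb : ∀ᵐ x ∂(volume.restrict (Ioo a T)), x ≠ b :=
      ae_restrict_of_ae (Measure.ae_ne volume b)
    filter_upwards [hb] with x hx
    rcases lt_or_gt_of_ne hx with hx | hx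
    · rw [indicator_of_notMem (by simpa using hx.le)]
      have h : Tendsto (fun n : ℕ => Real.exp (-Real.exp (n * (b - x)))) atTop (𝓝 0) := by
        refine Real.tendsto_exp_neg_atTop_nhds_zero.comp (Real.tendsto_exp_atTop.comp ?_)
        exact tendsto_natCast_atTop_atTop.atTop_mul_const (sub_pos.mpr hx)
      simpa using h.mul_const (f x)
    · rw [indicator_of_mem (by simpa using hx)]
      have h1 : Tendsto (fun n : ℕ => Real.exp (n * (b - x))) atTop (𝓝 0) := by
        refine Real.tendsto_exp_atBot.comp ?_
        exact tendsto_natCast_atTop_atTop.atTop_mul_const_of_neg (sub_neg.mpr hx)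
      have h : Tendsto (fun n : ℕ => Real.exp (-Real.exp (n * (b - x)))) atTop (𝓝 1) := by
        simpa [Function.comp_def] using (Real.continuous_exp.tendsto _).comp h1.neg
      simpa using h.mul_const (f x)

/-- In the series of `hasSum_integral_exp_neg_exp` the term `k = 0` is `∫ f`, independent of `n`.
Decay of the transform faster than `exp (-(b - a) s)` makes the other terms vanish as `n → ∞`. -/
theorem integral_indicator_Ioi_eq_of_expNegligible (hf : IntegrableOn f (Ioo a T))
    (h : ExpNegligible (T - a) fun s => laplaceOn a T s f) {b : ℝ} (hb : b < T) :
    ∫ x in Ioo a T, (Ioi b).indicator f x = ∫ x in Ioo a T, f x := by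
  -- This rate lies midway between `b - a` and `T - a`; `τ` below is its excess over `b - a`.
  obtain ⟨C, hC⟩ := (h ((b + T) / 2 - a) (by linarith)).bound
  obtain ⟨N, hN⟩ := eventually_atTop.mp hC
  have hC0 : 0 ≤ |C| := abs_nonneg C
  set τ := (T - b) / 2 with hτ
  have hτ0 : 0 < τ := by rw [hτ]; linarith
  have hlim : Tendsto (fun n : ℕ => |C| * Real.exp (-(n * τ)) * Real.exp 1) atTop (𝓝 0) := by
    have : Tendsto (fun n : ℕ => Real.exp (-(n * τ))) atTop (𝓝 0) :=
      Real.tendsto_exp_neg_atTop_nhds_zero.comp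
        (tendsto_natCast_atTop_atTop.atTop_mul_const hτ0)
    simpa using (this.const_mul |C|).mul_const (Real.exp 1)
  have hzero : Tendsto (fun n : ℕ => (∫ x in Ioo a T, Real.exp (-Real.exp (n * (b - x))) * f x) -
      ∫ x in Ioo a T, f x) atTop (𝓝 0) := by
    refine squeeze_zero_norm' ?_ hlim
    filter_upwards [eventually_ge_atTop (max 1 ⌈N⌉₊)] with n hn
    have hn1 : (1 : ℝ) ≤ n := by exact_mod_cast (le_max_left _ _).trans hn
    have hnN : N ≤ n := (Nat.le_ceil N).trans (by exact_mod_cast (le_max_right _ _).trans hn)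
    have hs := (hasSum_nat_add_iff' 1).mpr (hasSum_integral_exp_neg_exp hf b n)
    simp only [Finset.range_one, Finset.sum_singleton, pow_zero, Nat.factorial_zero,
      Nat.cast_one, div_one, Nat.cast_zero, zero_mul, Real.exp_zero, one_mul] at hs
    have h0 : laplaceOn a T 0 f = ∫ x in Ioo a T, f x := by simp [laplaceOn]
    rw [h0] at hs
    rw [← hs.tsum_eq]
    have he : HasSum (fun k : ℕ => (1 : ℝ) ^ k / (k.factorial : ℝ)) (Real.exp 1) := by
      rw [Real.exp_eq_exp_ℝ]
      exact NormedSpace.expSeries_div_hasSum_exp 1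
    refine tsum_of_norm_bounded (he.mul_left (|C| * Real.exp (-(n * τ)))) fun k => ?_
    have hk : (n : ℝ) ≤ ((k + 1 : ℕ) : ℝ) * n := by
      push_cast
      nlinarith [(Nat.cast_nonneg k : (0 : ℝ) ≤ k)]
    have hb1 := hN (((k + 1 : ℕ) : ℝ) * n) (hnN.trans hk)
    rw [norm_mul, norm_mul, norm_div, norm_pow, norm_neg, norm_one, one_pow, Real.norm_natCast,
      Real.norm_eq_abs (Real.exp _), Real.abs_exp, one_pow]
    rw [Real.norm_eq_abs (Real.exp _), Real.abs_exp] at hb1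
    set K : ℝ := ((k + 1 : ℕ) : ℝ) * n with hK
    calc 1 / ((k + 1).factorial : ℝ) * Real.exp (K * (b - a)) * ‖laplaceOn a T K f‖
        ≤ 1 / ((k + 1).factorial : ℝ) * Real.exp (K * (b - a)) *
            (|C| * Real.exp (-(((b + T) / 2 - a) * K))) := by
          gcongr
          exact hb1.trans (by gcongr; exact le_abs_self C)
      _ = |C| * Real.exp (-(K * τ)) * (1 / ((k + 1).factorial : ℝ)) := by
          have : -(K * τ) = K * (b - a) + -(((b + T) / 2 - a) * K) := by rw [hτ]; ring
          rw [this, Real.exp_add]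
          ring
      _ ≤ |C| * Real.exp (-(n * τ)) * (1 / (k.factorial : ℝ)) := by
          have h2 : k.factorial ≤ (k + 1).factorial := Nat.factorial_le (Nat.le_succ k)
          gcongr
  have := (tendsto_integral_exp_neg_exp hf b).sub_const (∫ x in Ioo a T, f x)
  exact sub_eq_zero.mp (tendsto_nhds_unique this hzero)

/-- A function on `(a, T)` whose Laplace transform decays like `exp (-(T - a) s)` vanishes. -/
theorem ae_eq_zero_of_expNegligible_laplaceOn (haT : a < T) (hf : IntegrableOn f (Ioo a T))
    (h : ExpNegligible (T - a) fun s => laplaceOn a T s f) :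
    f =ᵐ[volume.restrict (Ioo a T)] 0 := by
  have hii : IntervalIntegrable f volume a T :=
    (intervalIntegrable_iff_integrableOn_Ioo_of_le haT.le).mpr hf
  -- The mass beyond `b` is the total mass, so the primitive from `a` vanishes on `(a, T)`; Lebesgue
  -- differentiation then gives `f = 0` a.e.
  have hzero : ∀ b ∈ Ioo a T, ∫ x in a..b, f x = 0 := by
    intro b hb
    have h1 := integral_indicator_Ioi_eq_of_expNegligible hf h hb.2
    rw [setIntegral_indicator measurableSet_Ioi] at h1
    have h2 : Ioo a T ∩ Ioi b = Ioo b T := by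
      ext x
      simp only [mem_inter_iff, mem_Ioo, mem_Ioi]
      constructor
      · rintro ⟨⟨_, h2⟩, h3⟩; exact ⟨h3, h2⟩
      · rintro ⟨h3, h2⟩; exact ⟨⟨hb.1.trans h3, h2⟩, h3⟩
    rw [h2, ← integral_Ioc_eq_integral_Ioo, ← integral_Ioc_eq_integral_Ioo,
      ← intervalIntegral.integral_of_le hb.2.le, ← intervalIntegral.integral_of_le haT.le] at h1
    have h3 := intervalIntegral.integral_add_adjacent_intervals (μ := volume) (f := f)
      (a := a) (b := b) (c := T)
      (hii.mono_set (by rw [uIcc_of_le hb.1.le, uIcc_of_le haT.le]; exact Icc_subset_Icc le_rfl hb.2.le))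
      (hii.mono_set (by rw [uIcc_of_le hb.2.le, uIcc_of_le haT.le]; exact Icc_subset_Icc hb.1.le le_rfl))
    linarith
  rw [EventuallyEq, ae_restrict_iff' measurableSet_Ioo]
  filter_upwards [hii.ae_hasDerivAt_integral] with x hx hxm
  have hd := hx (by rw [uIcc_of_le haT.le]; exact Ioo_subset_Icc_self hxm) a left_mem_uIcc
  have h0 : (fun y => ∫ t in a..y, f t) =ᶠ[𝓝 x] fun _ => 0 := by
    filter_upwards [Ioo_mem_nhds hxm.1 hxm.2] with y hy using hzero y hy
  exact hd.unique ((hasDerivAt_const x (0 : ℝ)).congr_of_eventuallyEq h0)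

end Laplace

/-! ### Laplace transform of the Riemann–Liouville integral. -/

section RiemannLiouville

open scoped Convolution

/-- The kernel `u ↦ exp (-s u) u^(α - 1)` on `(0, ∞)`. -/
noncomputable def expRpowKernel (α s : ℝ) : ℝ → ℝ :=
  (Ioi 0).indicator fun u => u ^ (α - 1) * Real.exp (-(s * u))

/-- `f` restricted to `(a, T)`, with the weight `exp (-s (t - a))`. -/
noncomputable def expWeighted (a T s : ℝ) (f : ℝ → ℝ) : ℝ → ℝ :=
  (Ioo a T).indicator fun t => Real.exp (-(s * (t - a))) * f t

/-- The integral of `(x - t)^(α - 1) f(t)` over `t ∈ (a, T)`, `t < x`. -/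
noncomputable def rlTruncated (a T α : ℝ) (f : ℝ → ℝ) (x : ℝ) : ℝ :=
  ∫ t in Ioo a T ∩ Iio x, rlIntegrand α f x t

variable {a T α s : ℝ} {f : ℝ → ℝ}

theorem integral_expRpowKernel (hα : 0 < α) (hs : 0 < s) :
    ∫ u, expRpowKernel α s u = (1 / s) ^ α * Real.Gamma α := by
  rw [expRpowKernel, integral_indicator measurableSet_Ioi,
    Real.integral_rpow_mul_exp_neg_mul_Ioi hα hs]

/-- A non-integrable function has integral `0` by convention, whereas the Gamma integral is
positive. -/
theorem integrable_expRpowKernel (hα : 0 < α) (hs : 0 < s) : Integrable (expRpowKernel α s) := by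
  by_contra h
  have h1 := integral_expRpowKernel hα hs
  rw [integral_undef h] at h1
  have := Real.Gamma_pos_of_pos hα
  have : 0 < (1 / s) ^ α * Real.Gamma α := by positivity
  linarith

theorem integrable_expWeighted (hf : IntegrableOn f (Ioo a T)) (s : ℝ) :
    Integrable (expWeighted a T s f) :=
  (integrable_indicator_iff measurableSet_Ioo).mpr (integrableOn_exp_neg_mul hf s)

theorem integral_expWeighted : ∫ t, expWeighted a T s f t = laplaceOn a T s f := by
  rw [expWeighted, integral_indicator measurableSet_Ioo, laplaceOn]

/-- The exponential weights combine into a factor free of `t`, so the weighted fractional integral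
is a convolution of two integrable functions on the line. -/
theorem expWeighted_mul_expRpowKernel (x t : ℝ) :
    expWeighted a T s f t * expRpowKernel α s (x - t) =
      Real.exp (-(s * (x - a))) * (Ioo a T ∩ Iio x).indicator (rlIntegrand α f x) t := by
  rw [expWeighted, expRpowKernel]
  by_cases h1 : t ∈ Ioo a T
  · by_cases h2 : t < x
    · rw [indicator_of_mem h1, indicator_of_mem (by simpa using h2),
        indicator_of_mem (s := Ioo a T ∩ Iio x) ⟨h1, h2⟩, rlIntegrand]
      have : -(s * (x - a)) = -(s * (t - a)) + -(s * (x - t)) := by ring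
      rw [this, Real.exp_add]
      ring
    · rw [indicator_of_notMem (s := Ioi 0) (by simpa using h2),
        indicator_of_notMem (s := Ioo a T ∩ Iio x) (fun h => h2 h.2)]
      simp
  · rw [indicator_of_notMem h1, indicator_of_notMem (s := Ioo a T ∩ Iio x) (fun h => h1 h.1)]
    simp

theorem expWeighted_convolution_expRpowKernel (x : ℝ) :
    (expWeighted a T s f ⋆[ContinuousLinearMap.mul ℝ ℝ, volume] expRpowKernel α s) x =
      Real.exp (-(s * (x - a))) * rlTruncated a T α f x := by
  rw [convolution_def]
  simp only [ContinuousLinearMap.mul_apply', expWeighted_mul_expRpowKernel]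
  rw [integral_const_mul, integral_indicator (measurableSet_Ioo.inter measurableSet_Iio),
    rlTruncated]

theorem integrable_exp_mul_rlTruncated (hα : 0 < α) (hs : 0 < s) (hf : IntegrableOn f (Ioo a T)) :
    Integrable fun x => Real.exp (-(s * (x - a))) * rlTruncated a T α f x := by
  have h := (integrable_expWeighted hf s).integrable_convolution (ContinuousLinearMap.mul ℝ ℝ)
    (integrable_expRpowKernel hα hs)
  exact h.congr (ae_of_all _ expWeighted_convolution_expRpowKernel)

theorem integral_exp_mul_rlTruncated (hα : 0 < α) (hs : 0 < s) (hf : IntegrableOn f (Ioo a T)) :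
    ∫ x, Real.exp (-(s * (x - a))) * rlTruncated a T α f x =
      laplaceOn a T s f * ((1 / s) ^ α * Real.Gamma α) := by
  have h := integral_convolution (μ := volume) (ν := volume) (ContinuousLinearMap.mul ℝ ℝ)
    (integrable_expWeighted hf s) (integrable_expRpowKernel hα hs)
  simp only [expWeighted_convolution_expRpowKernel] at h
  rw [h, integral_expWeighted, integral_expRpowKernel hα hs]
  rfl

theorem ae_integrableOn_rlIntegrand (hα : 0 < α) (hf : IntegrableOn f (Ioo a T)) :
    ∀ᵐ x, IntegrableOn (rlIntegrand α f x) (Ioo a T ∩ Iio x) := by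
  have h := (integrable_expWeighted hf 1).ae_convolution_exists (ContinuousLinearMap.mul ℝ ℝ)
    (integrable_expRpowKernel hα one_pos)
  filter_upwards [h] with x hx
  rw [ConvolutionExistsAt] at hx
  simp only [ContinuousLinearMap.mul_apply', expWeighted_mul_expRpowKernel] at hx
  rw [← integrable_indicator_iff (measurableSet_Ioo.inter measurableSet_Iio)]
  refine (hx.const_mul (Real.exp (1 * (x - a)))).congr (ae_of_all _ fun t => ?_)
  simp only [← mul_assoc, ← Real.exp_add]
  simp

theorem Ioo_inter_Iio_of_mem {x : ℝ} (hx : x ∈ Ioo a T) : Ioo a T ∩ Iio x = Ioo a x := by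
  ext t
  simp only [mem_inter_iff, mem_Ioo, mem_Iio]
  exact ⟨fun h => ⟨h.1.1, h.2⟩, fun h => ⟨⟨h.1, h.2.trans hx.2⟩, h.2⟩⟩

theorem rlTruncated_eq_intervalIntegral {x : ℝ} (hx : x ∈ Ioo a T) :
    rlTruncated a T α f x = ∫ t in a..x, rlIntegrand α f x t := by
  rw [rlTruncated, Ioo_inter_Iio_of_mem hx, intervalIntegral.integral_of_le hx.1.le,
    integral_Ioc_eq_integral_Ioo]

theorem ae_intervalIntegrable_rlIntegrand (hα : 0 < α) (hf : IntegrableOn f (Ioo a T)) :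
    ∀ᵐ x ∂(volume.restrict (Ioo a T)), IntervalIntegrable (rlIntegrand α f x) volume a x := by
  rw [ae_restrict_iff' measurableSet_Ioo]
  filter_upwards [ae_integrableOn_rlIntegrand hα hf] with x hx hxm
  rwa [Ioo_inter_Iio_of_mem hxm, ← intervalIntegrable_iff_integrableOn_Ioo_of_le hxm.1.le] at hx

theorem integrableOn_rlTruncated (hα : 0 < α) (hf : IntegrableOn f (Ioo a T)) :
    IntegrableOn (rlTruncated a T α f) (Ioo a T) := by
  have h := integrableOn_exp_mul
    (integrable_exp_mul_rlTruncated hα one_pos hf).integrableOn (a := a) (T := T) 1 a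
  refine h.congr_fun (fun x _ => ?_) measurableSet_Ioo
  simp only [← mul_assoc, ← Real.exp_add]
  simp

theorem integrableOn_rlIntegral (hα : 0 < α) (hf : IntegrableOn f (Ioo a T)) :
    IntegrableOn (rlIntegral a α f) (Ioo a T) := by
  refine IntegrableOn.congr_fun ((integrableOn_rlTruncated hα hf).const_mul (1 / Real.Gamma α))
    (fun x hx => ?_) measurableSet_Ioo
  simp only [rlIntegral, rlTruncated_eq_intervalIntegral hx]

theorem abs_rlTruncated_le (x : ℝ) :
    |rlTruncated a T α f x| ≤ rlTruncated a T α (fun t => |f t|) x := by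
  refine abs_integral_le_integral_abs.trans_eq ?_
  refine setIntegral_congr_fun (measurableSet_Ioo.inter measurableSet_Iio) fun t ht => ?_
  have : 0 ≤ x - t := sub_nonneg.mpr (le_of_lt ht.2)
  simp only [rlIntegrand]
  rw [abs_mul, abs_of_nonneg (Real.rpow_nonneg this _)]

theorem rlTruncated_of_le {x : ℝ} (hx : x ≤ a) : rlTruncated a T α f x = 0 := by
  have : Ioo a T ∩ Iio x = ∅ := by
    ext t
    simp only [mem_inter_iff, mem_Ioo, mem_Iio, mem_empty_iff_false, iff_false]
    rintro ⟨h1, h2⟩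
    linarith [h1.1]
  rw [rlTruncated, this]
  simp

/-- The Laplace transform of the Riemann–Liouville integral, up to an exponentially small error
that is uniform in the order. -/
theorem abs_laplaceOn_rlIntegral_sub_le (haT : a < T) (hα : 0 < α) (hs : 1 ≤ s)
    (hf : IntegrableOn f (Ioo a T)) :
    |laplaceOn a T s (rlIntegral a α f) - (1 / s) ^ α * laplaceOn a T s f| ≤
      Real.exp (-((s - 1) * (T - a))) * ∫ x in Ioo a T, |f x| := by
  have hs0 : 0 < s := by linarith
  have hΓ := Real.Gamma_pos_of_pos hα
  have hint := integrable_exp_mul_rlTruncated hα hs0 hf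
  have hint1 := integrable_exp_mul_rlTruncated hα one_pos hf.abs
  have h1 : laplaceOn a T s (rlIntegral a α f) = (1 / Real.Gamma α) *
      ∫ x in Ioo a T, Real.exp (-(s * (x - a))) * rlTruncated a T α f x := by
    rw [laplaceOn, ← integral_const_mul]
    refine setIntegral_congr_fun measurableSet_Ioo fun x hx => ?_
    simp only [rlIntegral, rlTruncated_eq_intervalIntegral hx]
    ring
  -- Over the whole line the convolution theorem is exact; the error is the part over `x ≥ T`.
  have h2 : (∫ x in Ioo a T, Real.exp (-(s * (x - a))) * rlTruncated a T α f x) +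
      ∫ x in Ici T, Real.exp (-(s * (x - a))) * rlTruncated a T α f x =
      laplaceOn a T s f * ((1 / s) ^ α * Real.Gamma α) := by
    rw [← integral_exp_mul_rlTruncated hα hs0 hf, ← setIntegral_union _ measurableSet_Ici
      hint.integrableOn hint.integrableOn, Ioo_union_Ici_eq_Ioi haT]
    · refine setIntegral_eq_integral_of_forall_compl_eq_zero fun x hx => ?_
      rw [rlTruncated_of_le (by simpa using hx), mul_zero]
    · exact disjoint_left.mpr fun x hx hx' => not_lt_of_ge hx' hx.2
  -- For `x ≥ T`, `exp (-s (x - a)) ≤ exp (-(s - 1) (T - a)) exp (-(x - a))`. The full transform at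
  -- `1` then produces a factor `Γ(α)`, which cancels the normalization and leaves a bound free of
  -- `α`.
  have h3 : |∫ x in Ici T, Real.exp (-(s * (x - a))) * rlTruncated a T α f x| ≤
      Real.exp (-((s - 1) * (T - a))) *
        (laplaceOn a T 1 (fun t => |f t|) * ((1 / 1) ^ α * Real.Gamma α)) := by
    rw [← integral_exp_mul_rlTruncated hα one_pos hf.abs, ← integral_const_mul]
    refine abs_integral_le_integral_abs.trans ?_
    refine (setIntegral_mono_on hint.integrableOn.abs (hint1.const_mul _).integrableOn
      measurableSet_Ici fun x hx => ?_).trans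
      (setIntegral_le_integral (hint1.const_mul _) (ae_of_all _ fun x => ?_))
    · rw [abs_mul, Real.abs_exp, ← mul_assoc, ← Real.exp_add]
      refine mul_le_mul (Real.exp_le_exp.mpr ?_) (abs_rlTruncated_le x) (abs_nonneg _)
        (Real.exp_pos _).le
      have : T ≤ x := hx
      nlinarith
    · have := (abs_nonneg _).trans (abs_rlTruncated_le (a := a) (T := T) (α := α) (f := f) x)
      simp only [Pi.zero_apply]
      positivity
  have h4 : laplaceOn a T 1 (fun t => |f t|) ≤ ∫ x in Ioo a T, |f x| := by
    refine (le_abs_self _).trans ((abs_laplaceOn_le zero_le_one hf.abs).trans_eq ?_)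
    simp
  have h5 : laplaceOn a T s (rlIntegral a α f) - (1 / s) ^ α * laplaceOn a T s f =
      -(1 / Real.Gamma α) * ∫ x in Ici T, Real.exp (-(s * (x - a))) * rlTruncated a T α f x := by
    rw [h1, eq_sub_of_add_eq h2]
    field_simp
    ring
  rw [h5, abs_mul, abs_neg, abs_of_pos (one_div_pos.mpr hΓ)]
  calc 1 / Real.Gamma α * |∫ x in Ici T, Real.exp (-(s * (x - a))) * rlTruncated a T α f x|
      ≤ 1 / Real.Gamma α * (Real.exp (-((s - 1) * (T - a))) *
        (laplaceOn a T 1 (fun t => |f t|) * ((1 / 1) ^ α * Real.Gamma α))) := by gcongr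
    _ = Real.exp (-((s - 1) * (T - a))) * laplaceOn a T 1 (fun t => |f t|) := by
        rw [div_one, Real.one_rpow]
        field_simp
    _ ≤ _ := by gcongr

theorem expNegligible_laplaceOn_rlIntegral_sub (haT : a < T) (hα : 0 < α)
    (hf : IntegrableOn f (Ioo a T)) :
    ExpNegligible (T - a) fun s =>
      laplaceOn a T s (rlIntegral a α f) - (1 / s) ^ α * laplaceOn a T s f := by
  intro r hr
  refine IsBigO.of_bound (Real.exp (T - a) * ∫ x in Ioo a T, |f x|) ?_
  filter_upwards [eventually_ge_atTop 1] with s hs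
  rw [Real.norm_eq_abs, Real.norm_eq_abs, Real.abs_exp]
  refine (abs_laplaceOn_rlIntegral_sub_le haT hα hs hf).trans ?_
  have h0 : 0 ≤ ∫ x in Ioo a T, |f x| := integral_nonneg fun x => abs_nonneg _
  rw [mul_right_comm, ← Real.exp_add]
  gcongr
  nlinarith

end RiemannLiouville

/-! ### Operators commuting with integration. -/

section Commutant

variable {a T s : ℝ}

theorem L1On.integrableOn (f : L1On a T) : IntegrableOn f (Ioo a T) := L1.integrable_coeFn f

theorem intervalIntegral_congr_ae_restrict {f g : ℝ → ℝ}
    (h : f =ᵐ[volume.restrict (Ioo a T)] g) {x : ℝ} (hx : x ∈ Ioo a T) :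
    ∫ t in a..x, f t = ∫ t in a..x, g t := by
  rw [intervalIntegral.integral_of_le hx.1.le, intervalIntegral.integral_of_le hx.1.le,
    integral_Ioc_eq_integral_Ioo, integral_Ioc_eq_integral_Ioo]
  refine integral_congr_ae ?_
  exact ae_mono (Measure.restrict_mono (Ioo_subset_Ioo_right hx.2.le) le_rfl) h

/-- The function `x ↦ ∫ₓᵀ exp (s (x - t)) f(t) dt`. -/
noncomputable def backwardExpIntegral (a T s : ℝ) (f : ℝ → ℝ) (x : ℝ) : ℝ :=
  Real.exp (s * (x - a)) * ∫ t in x..T, Real.exp (-(s * (t - a))) * f t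

section Function

variable {f : ℝ → ℝ}

theorem intervalIntegrable_exp_neg_mul (haT : a < T) (hf : IntegrableOn f (Ioo a T)) (s : ℝ) :
    IntervalIntegrable (fun t => Real.exp (-(s * (t - a))) * f t) volume a T :=
  (intervalIntegrable_iff_integrableOn_Ioo_of_le haT.le).mpr (integrableOn_exp_neg_mul hf s)

theorem backwardExpIntegral_eq (haT : a < T) (hf : IntegrableOn f (Ioo a T)) {x : ℝ}
    (hx : x ∈ Icc a T) :
    backwardExpIntegral a T s f x = Real.exp (s * (x - a)) *
      (laplaceOn a T s f - ∫ t in a..x, Real.exp (-(s * (t - a))) * f t) := by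
  have hi := intervalIntegrable_exp_neg_mul haT hf s
  have h1 : laplaceOn a T s f = ∫ t in a..T, Real.exp (-(s * (t - a))) * f t := by
    rw [intervalIntegral.integral_of_le haT.le, integral_Ioc_eq_integral_Ioo, laplaceOn]
  rw [backwardExpIntegral, h1, intervalIntegral.integral_interval_sub_left hi
    (hi.mono_set (by rw [uIcc_of_le hx.1, uIcc_of_le haT.le]; exact Icc_subset_Icc_right hx.2))]

theorem absolutelyContinuousOnInterval_exp (s a c d : ℝ) :
    AbsolutelyContinuousOnInterval (fun u => Real.exp (s * (u - a))) c d := by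
  refine ContDiffOn.absolutelyContinuousOnInterval ?_
  exact ContDiff.contDiffOn (by fun_prop)

theorem hasDerivAt_exp_mul_sub (s a x : ℝ) :
    HasDerivAt (fun u => Real.exp (s * (u - a))) (s * Real.exp (s * (x - a))) x := by
  have h := (((hasDerivAt_id x).sub_const a).const_mul s).exp
  simpa [mul_comm] using h

theorem intervalIntegral_exp (s a x : ℝ) :
    s * ∫ u in a..x, Real.exp (s * (u - a)) = Real.exp (s * (x - a)) - 1 := by
  rw [← intervalIntegral.integral_const_mul,
    intervalIntegral.integral_eq_sub_of_hasDerivAt (fun u _ => hasDerivAt_exp_mul_sub s a u)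
      (Continuous.intervalIntegrable (by fun_prop) _ _)]
  simp

theorem continuousOn_intervalIntegral_exp_neg_mul (haT : a < T) (hf : IntegrableOn f (Ioo a T))
    (s : ℝ) : ContinuousOn (fun x => ∫ t in a..x, Real.exp (-(s * (t - a))) * f t) (Icc a T) := by
  have h := (intervalIntegrable_exp_neg_mul haT hf
    s).absolutelyContinuousOnInterval_intervalIntegral (left_mem_uIcc)
  simpa [uIcc_of_le haT.le] using h.continuousOn

theorem continuousOn_backwardExpIntegral (haT : a < T) (hf : IntegrableOn f (Ioo a T)) (s : ℝ) :
    ContinuousOn (backwardExpIntegral a T s f) (Icc a T) := by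
  refine ContinuousOn.congr (ContinuousOn.mul (by fun_prop) (continuousOn_const.sub
    (continuousOn_intervalIntegral_exp_neg_mul haT hf s)))
    fun x hx => backwardExpIntegral_eq haT hf hx

theorem integrableOn_backwardExpIntegral (haT : a < T) (hf : IntegrableOn f (Ioo a T)) (s : ℝ) :
    IntegrableOn (backwardExpIntegral a T s f) (Ioo a T) :=
  ((continuousOn_backwardExpIntegral haT hf s).integrableOn_Icc).mono_set Ioo_subset_Icc_self

theorem abs_backwardExpIntegral_le (hs : 0 ≤ s) (hf : IntegrableOn f (Ioo a T)) {x : ℝ}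
    (hx : x ∈ Ioo a T) : |backwardExpIntegral a T s f x| ≤ ∫ t in Ioo a T, |f t| := by
  have hsub : Ioo x T ⊆ Ioo a T := Ioo_subset_Ioo_left hx.1.le
  rw [backwardExpIntegral, intervalIntegral.integral_of_le hx.2.le, integral_Ioc_eq_integral_Ioo,
    ← integral_const_mul]
  refine abs_integral_le_integral_abs.trans ?_
  refine le_trans ?_ (setIntegral_mono_set hf.abs (ae_of_all _ fun x => abs_nonneg _)
    (LE.le.eventuallyLE hsub))
  refine setIntegral_mono_on (((integrableOn_exp_neg_mul hf s).mono_set hsub).const_mul _).abs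
    (hf.mono_set hsub).abs measurableSet_Ioo fun t ht => ?_
  rw [← mul_assoc, ← Real.exp_add, abs_mul, Real.abs_exp]
  refine mul_le_of_le_one_left (abs_nonneg _) (Real.exp_le_one_iff.mpr ?_)
  nlinarith [ht.1]

/-- The backward exponential integral solves a resolvent equation for integration from `a`. -/
theorem backwardExpIntegral_sub_integral (haT : a < T) (hf : IntegrableOn f (Ioo a T)) {x : ℝ}
    (hx : x ∈ Ioo a T) :
    backwardExpIntegral a T s f x - s * ∫ u in a..x, backwardExpIntegral a T s f u =
      laplaceOn a T s f - ∫ u in a..x, f u := by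
  set P : ℝ → ℝ := fun x => ∫ t in a..x, Real.exp (-(s * (t - a))) * f t with hP
  have hi : IntervalIntegrable (fun t => Real.exp (-(s * (t - a))) * f t) volume a x :=
    (intervalIntegrable_exp_neg_mul haT hf s).mono_set
      (by rw [uIcc_of_le hx.1.le, uIcc_of_le haT.le]; exact Icc_subset_Icc_right hx.2.le)
  have hPac : AbsolutelyContinuousOnInterval P a x :=
    hi.absolutelyContinuousOnInterval_intervalIntegral left_mem_uIcc
  -- Integration by parts of `exp (s (u - a))` against the primitive `P`, whose derivative cancels
  -- the exponential and leaves `f`.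
  have hparts := (absolutelyContinuousOnInterval_exp s a a x).integral_mul_deriv_eq_deriv_mul hPac
  have h1 : ∫ u in a..x, Real.exp (s * (u - a)) * deriv P u = ∫ u in a..x, f u := by
    refine intervalIntegral.integral_congr_ae ?_
    filter_upwards [hi.ae_hasDerivAt_integral] with u hu hum
    rw [(hu (uIoc_subset_uIcc hum) a left_mem_uIcc).deriv, ← mul_assoc, ← Real.exp_add]
    simp
  have h2 : ∫ u in a..x, deriv (fun u => Real.exp (s * (u - a))) u * P u =
      s * ∫ u in a..x, Real.exp (s * (u - a)) * P u := by
    rw [← intervalIntegral.integral_const_mul]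
    congr 1 with u
    rw [(hasDerivAt_exp_mul_sub s a u).deriv, mul_assoc]
  have h3 : ∫ u in a..x, backwardExpIntegral a T s f u =
      (∫ u in a..x, Real.exp (s * (u - a))) * laplaceOn a T s f -
        ∫ u in a..x, Real.exp (s * (u - a)) * P u := by
    rw [← intervalIntegral.integral_mul_const, ← intervalIntegral.integral_sub]
    · refine intervalIntegral.integral_congr fun u hu => ?_
      rw [uIcc_of_le hx.1.le] at hu
      simp only [backwardExpIntegral_eq haT hf (Icc_subset_Icc_right hx.2.le hu), hP]
      ring
    · exact Continuous.intervalIntegrable (by fun_prop) _ _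
    · exact ContinuousOn.intervalIntegrable (ContinuousOn.mul (by fun_prop) hPac.continuousOn)
  have h4 : P a = 0 := by simp [hP]
  rw [h1, h2, h4] at hparts
  have h5 := intervalIntegral_exp s a x
  rw [backwardExpIntegral_eq haT hf (Ioo_subset_Icc_self hx), h3]
  change _ * (_ - P x) - _ = _
  linear_combination hparts - laplaceOn a T s f * h5

/-- The Volterra operator has no nonzero eigenvalue. -/
theorem ae_eq_zero_of_eq_mul_integral (haT : a < T) (hf : IntegrableOn f (Ioo a T))
    (h : ∀ᵐ x ∂(volume.restrict (Ioo a T)), f x = s * ∫ t in a..x, f t) :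
    f =ᵐ[volume.restrict (Ioo a T)] 0 := by
  have hi : IntervalIntegrable f volume a T :=
    (intervalIntegrable_iff_integrableOn_Ioo_of_le haT.le).mpr hf
  set H : ℝ → ℝ := fun x => ∫ t in a..x, f t with hH
  have hHac : AbsolutelyContinuousOnInterval H a T :=
    hi.absolutelyContinuousOnInterval_intervalIntegral left_mem_uIcc
  -- `exp (-s (x - a)) H(x)` is absolutely continuous with derivative zero a.e., hence constant, and
  -- it vanishes at `a`.
  obtain ⟨C, hC⟩ := ((absolutelyContinuousOnInterval_exp (-s) a a T).fun_mul
    hHac).const_of_ae_hasDerivAt_zero <| by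
      rw [ae_restrict_iff' measurableSet_Ioo] at h
      filter_upwards [hi.ae_hasDerivAt_integral, h, Measure.ae_ne volume a, Measure.ae_ne volume T]
        with x hx hx2 hxa hxT hxm
      have hd := hx hxm a left_mem_uIcc
      rw [uIcc_of_le haT.le] at hxm
      have hxo : x ∈ Ioo a T := ⟨lt_of_le_of_ne hxm.1 hxa.symm, lt_of_le_of_ne hxm.2 hxT⟩
      refine ((hasDerivAt_exp_mul_sub (-s) a x).mul hd).congr_deriv ?_
      rw [hx2 hxo]
      ring
  have hC0 : C = 0 := by
    rw [← hC a left_mem_uIcc]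
    simp [hH]
  rw [EventuallyEq, ae_restrict_iff' measurableSet_Ioo]
  rw [ae_restrict_iff' measurableSet_Ioo] at h
  filter_upwards [h] with x hx hxm
  have h1 := hC x (by rw [uIcc_of_le haT.le]; exact Ioo_subset_Icc_self hxm)
  rw [hC0] at h1
  have h2 : H x = 0 := (mul_eq_zero.mp h1).resolve_left (Real.exp_pos _).ne'
  rw [hx hxm]
  simp only [hH] at h2
  simp [h2]

end Function

/-- The exponential `x ↦ exp (s (x - a))` as an element of `L¹(a, T)`. -/
noncomputable def expL1 (a T s : ℝ) : L1On a T :=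
  Integrable.toL1 (fun x => Real.exp (s * (x - a)))
    ((ContinuousOn.integrableOn_Icc (by fun_prop)).mono_set Ioo_subset_Icc_self)

theorem coeFn_expL1 (a T s : ℝ) :
    expL1 a T s =ᵐ[volume.restrict (Ioo a T)] fun x => Real.exp (s * (x - a)) :=
  Integrable.coeFn_toL1 _

theorem coeFn_oneL1 (a T : ℝ) : oneL1 a T =ᵐ[volume.restrict (Ioo a T)] fun _ => 1 :=
  Lp.coeFn_const ..

theorem L1On.norm_eq (f : L1On a T) : ‖f‖ = ∫ x in Ioo a T, |f x| := L1.norm_eq_integral_norm f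

theorem norm_inv_expL1_expNegligible (haT : a < T) :
    ExpNegligible (T - a) fun s => ‖expL1 a T s‖⁻¹ := by
  intro r hr
  -- The exponential is at least `exp (r s)` on `(c, T)`; the maximum keeps this interval inside
  -- `(a, T)` when `r < 0`.
  set c := max (a + r) a with hc
  have hcT : c < T := max_lt (by linarith) haT
  refine IsBigO.of_bound (T - c)⁻¹ ?_
  filter_upwards [eventually_ge_atTop 0] with s hs
  have hlow : (T - c) * Real.exp (r * s) ≤ ‖expL1 a T s‖ := by
    have h1 : ‖expL1 a T s‖ = ∫ x in Ioo a T, Real.exp (s * (x - a)) := by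
      rw [L1On.norm_eq]
      refine integral_congr_ae ?_
      filter_upwards [coeFn_expL1 a T s] with x hx
      rw [hx, Real.abs_exp]
    have hi : IntegrableOn (fun x => Real.exp (s * (x - a))) (Ioo a T) :=
      (ContinuousOn.integrableOn_Icc (by fun_prop)).mono_set Ioo_subset_Icc_self
    have hsub : Ioo c T ⊆ Ioo a T := Ioo_subset_Ioo_left (le_max_right _ _)
    rw [h1]
    refine le_trans ?_ (setIntegral_mono_set hi (ae_of_all _ fun x => (Real.exp_pos _).le)
      (LE.le.eventuallyLE hsub))
    have h2 : (T - c) * Real.exp (r * s) = ∫ _ in Ioo c T, Real.exp (r * s) := by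
      rw [setIntegral_const, smul_eq_mul, Real.volume_real_Ioo_of_le hcT.le]
    rw [h2]
    refine setIntegral_mono_on (integrableOn_const (by simp)) (hi.mono_set hsub)
      measurableSet_Ioo fun x hx => Real.exp_le_exp.mpr ?_
    have : a + r ≤ c := le_max_left _ _
    nlinarith [hx.1]
  rw [norm_inv, norm_norm, Real.norm_eq_abs, Real.abs_exp, Real.exp_neg, ← mul_inv]
  have : 0 < T - c := sub_pos.mpr hcT
  gcongr

/-- The backward exponential integral as an element of `L¹(a, T)`. -/
noncomputable def backwardExpL1 (haT : a < T) (s : ℝ) (f : L1On a T) : L1On a T :=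
  Integrable.toL1 (backwardExpIntegral a T s f) (integrableOn_backwardExpIntegral haT f.integrableOn s)

theorem coeFn_backwardExpL1 (haT : a < T) (s : ℝ) (f : L1On a T) :
    backwardExpL1 haT s f =ᵐ[volume.restrict (Ioo a T)] backwardExpIntegral a T s f :=
  Integrable.coeFn_toL1 _

theorem norm_backwardExpL1_le (haT : a < T) (hs : 0 ≤ s) (f : L1On a T) :
    ‖backwardExpL1 haT s f‖ ≤ (T - a) * ‖f‖ := by
  have h1 : ‖backwardExpL1 haT s f‖ = ∫ x in Ioo a T, |backwardExpIntegral a T s f x| := by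
    rw [L1On.norm_eq]
    refine integral_congr_ae ?_
    filter_upwards [coeFn_backwardExpL1 haT s f] with x hx
    rw [hx]
  have h2 : (T - a) * ‖f‖ = ∫ _ in Ioo a T, ‖f‖ := by
    rw [setIntegral_const, smul_eq_mul, Real.volume_real_Ioo_of_le haT.le]
  rw [h1, h2]
  refine setIntegral_mono_on (integrableOn_backwardExpIntegral haT f.integrableOn s).abs
    (integrableOn_const (by simp)) measurableSet_Ioo fun x hx => ?_
  rw [L1On.norm_eq]
  exact abs_backwardExpIntegral_le hs f.integrableOn hx

variable {V A : L1On a T →L[ℝ] L1On a T}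

theorem expL1_sub_smul_volterra
    (hV : ∀ f : L1On a T, ∀ᵐ x ∂(volume.restrict (Ioo a T)), V f x = ∫ t in a..x, f t) :
    expL1 a T s - s • V (expL1 a T s) = oneL1 a T := by
  refine Lp.ext ?_
  filter_upwards [Lp.coeFn_sub (expL1 a T s) (s • V (expL1 a T s)),
    Lp.coeFn_smul s (V (expL1 a T s)), hV (expL1 a T s), coeFn_expL1 a T s, coeFn_oneL1 a T,
    ae_restrict_mem measurableSet_Ioo] with x h1 h2 h3 h4 h5 hx
  rw [h1, Pi.sub_apply, h2, Pi.smul_apply, h3, h4, h5, smul_eq_mul,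
    intervalIntegral_congr_ae_restrict (coeFn_expL1 a T s) hx, intervalIntegral_exp]
  ring

/-- With `expL1_sub_smul_volterra`, this splits `(1 - sV)⁻¹ V f` into the transform of `f` times the
growing exponential, minus a remainder bounded uniformly in `s ≥ 0`. -/
theorem backwardExpL1_sub_smul_volterra (haT : a < T)
    (hV : ∀ f : L1On a T, ∀ᵐ x ∂(volume.restrict (Ioo a T)), V f x = ∫ t in a..x, f t)
    (f : L1On a T) :
    backwardExpL1 haT s f - s • V (backwardExpL1 haT s f) =
      laplaceOn a T s f • oneL1 a T - V f := by
  refine Lp.ext ?_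
  filter_upwards [Lp.coeFn_sub (backwardExpL1 haT s f) (s • V (backwardExpL1 haT s f)),
    Lp.coeFn_smul s (V (backwardExpL1 haT s f)), hV (backwardExpL1 haT s f),
    coeFn_backwardExpL1 haT s f, coeFn_oneL1 a T,
    Lp.coeFn_sub (laplaceOn a T s f • oneL1 a T) (V f), hV f,
    Lp.coeFn_smul (laplaceOn a T s f) (oneL1 a T),
    ae_restrict_mem measurableSet_Ioo] with x h1 h2 h3 h4 h5 h6 h7 h8 hx
  rw [h1, Pi.sub_apply, h2, Pi.smul_apply, h3, h4, h6, Pi.sub_apply, h8, Pi.smul_apply, h5, h7,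
    smul_eq_mul, smul_eq_mul, mul_one,
    intervalIntegral_congr_ae_restrict (coeFn_backwardExpL1 haT s f) hx,
    backwardExpIntegral_sub_integral haT f.integrableOn hx]

theorem eq_zero_of_eq_smul_volterra (haT : a < T)
    (hV : ∀ f : L1On a T, ∀ᵐ x ∂(volume.restrict (Ioo a T)), V f x = ∫ t in a..x, f t)
    {f : L1On a T} (h : f - s • V f = 0) : f = 0 := by
  refine Lp.ext ?_
  have h0 : f =ᵐ[volume.restrict (Ioo a T)] 0 := by
    refine ae_eq_zero_of_eq_mul_integral (s := s) haT f.integrableOn ?_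
    have h1 := Lp.coeFn_smul s (V f)
    rw [← sub_eq_zero.mp h] at h1
    filter_upwards [h1, hV f] with x h2 h3
    rw [h2, Pi.smul_apply, h3, smul_eq_mul]
  exact h0.trans (Lp.coeFn_zero ..).symm

theorem abs_laplaceOn_le_norm (hs : 0 ≤ s) (f : L1On a T) : |laplaceOn a T s f| ≤ ‖f‖ := by
  rw [L1On.norm_eq]
  exact abs_laplaceOn_le hs f.integrableOn

/-- The defect in the convolution theorem for an operator commuting with integration. -/
theorem laplaceOn_commutant_smul_expL1 (haT : a < T)
    (hV : ∀ f : L1On a T, ∀ᵐ x ∂(volume.restrict (Ioo a T)), V f x = ∫ t in a..x, f t)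
    (hA : ∀ f, A (V f) = V (A f)) (f : L1On a T) :
    (laplaceOn a T s (A f) - s * laplaceOn a T s f * laplaceOn a T s (A (oneL1 a T))) •
        expL1 a T s =
      laplaceOn a T s f • (A (oneL1 a T) - s • backwardExpL1 haT s (A (oneL1 a T))) -
        A (backwardExpL1 haT s f) + backwardExpL1 haT s (A f) := by
  -- Injectivity of `1 - sV` allows identities to be checked after applying it.
  have hinj : ∀ g h : L1On a T, g - s • V g = h - s • V h → g = h := by
    intro g h hgh
    refine sub_eq_zero.mp (eq_zero_of_eq_smul_volterra (s := s) haT hV ?_)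
    rw [map_sub, smul_sub]
    linear_combination (norm := module) hgh
  have he := expL1_sub_smul_volterra (s := s) hV
  have hAe := congrArg A he
  rw [map_sub, map_smul, hA] at hAe
  have hR := fun g => backwardExpL1_sub_smul_volterra (s := s) haT hV g
  have hAR := congrArg A (hR f)
  rw [map_sub, map_sub, map_smul, map_smul, hA, hA] at hAR
  have h1 : A (expL1 a T s) = A (oneL1 a T) + s • (laplaceOn a T s (A (oneL1 a T)) •
      expL1 a T s - backwardExpL1 haT s (A (oneL1 a T))) := by
    refine hinj _ _ ?_
    have h2 := hR (A (oneL1 a T))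
    rw [hAe]
    simp only [map_add, map_sub, map_smul]
    linear_combination (norm := module) s • h2 - (s * laplaceOn a T s (A (oneL1 a T))) • he
  -- Both sides are `(1 - sV)⁻¹ V (A f)`, as `A` commutes with `V`.
  have h3 : laplaceOn a T s f • A (expL1 a T s) - A (backwardExpL1 haT s f) =
      laplaceOn a T s (A f) • expL1 a T s - backwardExpL1 haT s (A f) := by
    refine hinj _ _ ?_
    have h4 := hR (A f)
    simp only [map_sub, map_smul]
    linear_combination (norm := module) laplaceOn a T s f • hAe - hAR - laplaceOn a T s (A f) • he + h4
  rw [h1] at h3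
  linear_combination (norm := module) -h3

/-- Convolution theorem: an operator commuting with integration acts, up to an exponentially small
error, by multiplication on the Laplace transforms. -/
theorem expNegligible_laplaceOn_commutant (haT : a < T)
    (hV : ∀ f : L1On a T, ∀ᵐ x ∂(volume.restrict (Ioo a T)), V f x = ∫ t in a..x, f t)
    (hA : ∀ f, A (V f) = V (A f)) (f : L1On a T) :
    ExpNegligible (T - a) fun s =>
      laplaceOn a T s (A f) - s * laplaceOn a T s f * laplaceOn a T s (A (oneL1 a T)) := by
  set u := A (oneL1 a T) with hu
  set C := ‖f‖ * (‖u‖ + (T - a) * ‖u‖) + ‖A‖ * ((T - a) * ‖f‖) + (T - a) * ‖A f‖ with hC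
  refine ((norm_inv_expL1_expNegligible haT).mul_left 1
    (isBigO_refl (fun s : ℝ => s ^ (1 : ℝ)) atTop)).of_isBigO (IsBigO.of_bound C ?_)
  filter_upwards [eventually_ge_atTop 1, eventually_gt_atTop 0] with s hs hs0
  have hL : 0 < T - a := sub_pos.mpr haT
  have key := congrArg norm (laplaceOn_commutant_smul_expL1 (s := s) haT hV hA f)
  have hpos : 0 < ‖expL1 a T s‖ := by
    rw [norm_pos_iff]
    intro h0
    have h1 := coeFn_expL1 a T s
    rw [h0] at h1
    have h2 : ∀ᵐ x ∂(volume.restrict (Ioo a T)), False := by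
      filter_upwards [h1, Lp.coeFn_zero ℝ 1 (volume.restrict (Ioo a T))] with x h3 h4
      rw [h4] at h3
      exact (Real.exp_pos _).ne h3
    have h5 : volume.restrict (Ioo a T) = 0 :=
      ae_eq_bot.mp (eventually_false_iff_eq_bot.mp h2)
    rw [Measure.restrict_eq_zero, Real.volume_Ioo] at h5
    simp only [ENNReal.ofReal_eq_zero] at h5
    linarith
  rw [norm_smul] at key
  -- The defect times an exponential of norm about `exp ((T - a) s)` grows at most linearly in `s`,
  -- so the defect itself is negligible.
  have hbound : ‖laplaceOn a T s f • (u - s • backwardExpL1 haT s u) -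
      A (backwardExpL1 haT s f) + backwardExpL1 haT s (A f)‖ ≤ C * s := by
    have h1 : ‖laplaceOn a T s f • (u - s • backwardExpL1 haT s u)‖ ≤
        ‖f‖ * (‖u‖ + s * ((T - a) * ‖u‖)) := by
      rw [norm_smul, Real.norm_eq_abs]
      refine mul_le_mul (abs_laplaceOn_le_norm hs0.le f) ?_ (norm_nonneg _) (norm_nonneg _)
      refine (norm_sub_le _ _).trans ?_
      rw [norm_smul, Real.norm_eq_abs, abs_of_pos hs0]
      gcongr
      exact norm_backwardExpL1_le haT hs0.le u
    have h2 : ‖A (backwardExpL1 haT s f)‖ ≤ ‖A‖ * ((T - a) * ‖f‖) :=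
      (A.le_opNorm _).trans (by gcongr; exact norm_backwardExpL1_le haT hs0.le f)
    have h3 := norm_backwardExpL1_le haT hs0.le (A f)
    refine (norm_add_le _ _).trans ((add_le_add_left (norm_sub_le _ _) _).trans ?_)
    refine (add_le_add (add_le_add h1 h2) h3).trans ?_
    have h4 : 0 ≤ ‖f‖ * ‖u‖ := by positivity
    have h5 : 0 ≤ ‖A‖ * ((T - a) * ‖f‖) := by positivity
    have h6 : 0 ≤ (T - a) * ‖A f‖ := by positivity
    rw [hC]
    nlinarith
  rw [Real.rpow_one, norm_mul, norm_inv, norm_norm, Real.norm_eq_abs s, abs_of_pos hs0,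
    ← mul_assoc, ← div_eq_mul_inv, le_div_iff₀ hpos, key]
  exact hbound

end Commutant

/-! ### Powers and roots modulo negligible functions. -/

namespace ExpNegligible

variable {L : ℝ} {X Y : ℝ → ℝ}

theorem mul_isBigO_one (hY : ExpNegligible L Y) (hX : X =O[atTop] fun _ => (1 : ℝ)) :
    ExpNegligible L (fun s => X s * Y s) :=
  hY.mul_left 0 (hX.congr_right fun s => (Real.rpow_zero s).symm)

theorem pow_sub_one (hL : 0 < L) (hX : ExpNegligible L fun s => X s - 1) (n : ℕ) :
    ExpNegligible L fun s => X s ^ n - 1 := by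
  have hb : X =O[atTop] fun _ => (1 : ℝ) := by
    have h := (hX.tendsto_zero hL).add_const 1
    simp only [sub_add_cancel] at h
    exact h.isBigO_one ℝ
  induction n with
  | zero => exact fun r _ => by simpa using isBigO_zero _ _
  | succ n ih =>
    refine ((ih.mul_isBigO_one hb).add hX).congr' (Eventually.of_forall fun s => ?_)
    ring

/-- A function with a negligible distance to a square is determined by its powers. -/
theorem sub_one_of_pow (hL : 0 < L) {n : ℕ} (hn : n ≠ 0) (hX : ExpNegligible L fun s => X s ^ n - 1)
    (hY : ExpNegligible L fun s => X s - Y s ^ 2) : ExpNegligible L fun s => X s - 1 := by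
  refine hX.of_isBigO (IsBigO.of_bound 1 ?_)
  have h1 := (hX.tendsto_zero hL).eventually (lt_mem_nhds (by norm_num : -(1 / 2 : ℝ) < 0))
  have h2 := (hY.tendsto_zero hL).eventually (lt_mem_nhds (by norm_num : -(1 / 2 : ℝ) < 0))
  filter_upwards [h1, h2] with s hs1 hs2
  -- A negative `X s` would lie in `(-1/2, 0)`, being within `1/2` of a square from below; then `|X
  -- s ^ n| ≤ 1/2`, against `X s ^ n > 1/2`.
  have hX0 : 0 ≤ X s := by
    by_contra hneg
    have h3 : |X s| ≤ 1 / 2 := by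
      rw [abs_le]
      constructor <;> nlinarith [sq_nonneg (Y s)]
    have h4 : |X s| ^ n ≤ |X s| := pow_le_of_le_one (abs_nonneg _) (by linarith) hn
    have h5 := le_abs_self (X s ^ n)
    rw [abs_pow] at h5
    linarith
  rw [one_mul, Real.norm_eq_abs, Real.norm_eq_abs]
  -- For `X s ≥ 0` and `n ≥ 1`, taking the power moves `X s` no closer to `1`.
  rcases le_total 1 (X s) with h | h
  · have := le_self_pow₀ h hn
    rw [abs_of_nonneg (by linarith), abs_of_nonneg (by linarith)]
    linarith
  · have := pow_le_of_le_one hX0 h hn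
    rw [abs_of_nonpos (by linarith), abs_of_nonpos (by linarith)]
    linarith

end ExpNegligible

/-! ### Symbols of the family: integer, rational, then real orders. -/

section Family

variable {a T : ℝ}

theorem abs_laplaceOn_sub_le {s : ℝ} (hs : 0 ≤ s) (f g : L1On a T) :
    |laplaceOn a T s f - laplaceOn a T s g| ≤ ‖f - g‖ := by
  have h : laplaceOn a T s (fun x => f x - g x) = laplaceOn a T s ⇑(f - g) :=
    laplaceOn_congr s (Lp.coeFn_sub f g).symm
  rw [← laplaceOn_sub s f.integrableOn g.integrableOn, h]
  exact abs_laplaceOn_le_norm hs _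

theorem continuous_laplaceOn {s : ℝ} (hs : 0 ≤ s) :
    Continuous fun f : L1On a T => laplaceOn a T s f :=
  (LipschitzWith.of_dist_le_mul (K := 1) fun f g => by
    simpa [Real.dist_eq, dist_eq_norm] using abs_laplaceOn_sub_le hs f g).continuous

theorem laplaceOn_oneL1_sub_expNegligible (haT : a < T) :
    ExpNegligible (T - a) fun s => laplaceOn a T s (oneL1 a T) - 1 / s := by
  intro r hr
  refine IsBigO.of_bound 1 ?_
  filter_upwards [eventually_ge_atTop 1] with s hs
  have h1 : laplaceOn a T s (oneL1 a T) = ∫ u in a..T, Real.exp (-s * (u - a)) := by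
    rw [laplaceOn_congr s (coeFn_oneL1 a T), intervalIntegral.integral_of_le haT.le,
      integral_Ioc_eq_integral_Ioo, laplaceOn]
    simp
  have h2 := intervalIntegral_exp (-s) a T
  rw [← h1] at h2
  have hs0 : 0 < s := by linarith
  have h3 : laplaceOn a T s (oneL1 a T) - 1 / s = -(Real.exp (-s * (T - a)) / s) := by
    field_simp
    rw [← neg_mul]
    linarith
  rw [h3, norm_neg, norm_div, Real.norm_eq_abs, Real.norm_eq_abs, Real.norm_eq_abs, Real.abs_exp,
    Real.abs_exp, abs_of_pos hs0, one_mul]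
  refine (div_le_self (Real.exp_pos _).le hs).trans (Real.exp_le_exp.mpr ?_)
  nlinarith

/-- A family of operators on `L¹(a, T)` satisfying the index law and interpolating iterated
integration. -/
structure IsFractionalFamily (a T : ℝ) (J : ℝ → (L1On a T →L[ℝ] L1On a T)) : Prop where
  lt : a < T
  one_apply : ∀ f : L1On a T, ∀ᵐ x ∂(volume.restrict (Ioo a T)), J 1 f x = ∫ t in a..x, f t
  add : ∀ α β : ℝ, 0 < α → 0 < β → J (α + β) = (J α).comp (J β)

/-- The normalized symbol `s^(α + 1) · L(A 1)(s)` of an operator of order `α`. -/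
noncomputable def laplaceSymbol (α : ℝ) (A : L1On a T →L[ℝ] L1On a T) (s : ℝ) : ℝ :=
  s ^ (α + 1) * laplaceOn a T s (A (oneL1 a T))

/-- The operator `A` has, up to an exponentially small error, the Laplace symbol of the
Riemann–Liouville integral of order `α`. -/
def HasRLSymbol (α : ℝ) (A : L1On a T →L[ℝ] L1On a T) : Prop :=
  ExpNegligible (T - a) fun s => laplaceSymbol α A s - 1

theorem laplaceSymbol_isBigO (α : ℝ) (A : L1On a T →L[ℝ] L1On a T) :
    laplaceSymbol α A =O[atTop] fun s => s ^ (α + 1) := by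
  refine IsBigO.of_bound ‖A (oneL1 a T)‖ ?_
  filter_upwards [eventually_ge_atTop 0] with s hs
  rw [laplaceSymbol, norm_mul, mul_comm]
  gcongr
  exact abs_laplaceOn_le_norm hs _

theorem HasRLSymbol.of_sub (haT : a < T) {α : ℝ} {A : L1On a T →L[ℝ] L1On a T}
    (h : ExpNegligible (T - a) fun s => laplaceOn a T s (A (oneL1 a T)) -
      (1 / s) ^ α * laplaceOn a T s (oneL1 a T)) : HasRLSymbol α A := by
  refine ((h.mul_left (α + 1) (isBigO_refl _ _)).add
    ((laplaceOn_oneL1_sub_expNegligible haT).mul_left 1 (isBigO_refl _ _))).congr' ?_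
  filter_upwards [eventually_gt_atTop 0] with s hs
  have h1 : s ^ (α + 1) * (1 / s) ^ α = s := by
    rw [one_div, Real.inv_rpow hs.le, Real.rpow_add_one hs.ne']
    have := (Real.rpow_pos_of_pos hs α).ne'
    field_simp
  rw [laplaceSymbol, mul_sub, ← mul_assoc, h1, Real.rpow_one]
  field_simp
  ring

namespace IsFractionalFamily

variable {J : ℝ → (L1On a T →L[ℝ] L1On a T)}

theorem commute (hJ : IsFractionalFamily a T J) {α : ℝ} (hα : 0 < α) (f : L1On a T) :
    J α (J 1 f) = J 1 (J α f) := by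
  rw [← ContinuousLinearMap.comp_apply, ← hJ.add α 1 hα one_pos, add_comm,
    hJ.add 1 α one_pos hα, ContinuousLinearMap.comp_apply]

/-- The convolution theorem for `J α` applied to `J β 1`. -/
theorem laplaceSymbol_add (hJ : IsFractionalFamily a T J) {α β : ℝ} (hα : 0 < α) (hβ : 0 < β) :
    ExpNegligible (T - a) fun s =>
      laplaceSymbol (α + β) (J (α + β)) s - laplaceSymbol α (J α) s * laplaceSymbol β (J β) s := by
  have h := expNegligible_laplaceOn_commutant hJ.lt hJ.one_apply (fun f => hJ.commute hα f)
    (J β (oneL1 a T))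
  refine (h.mul_left (α + β + 1) (isBigO_refl _ _)).congr' ?_
  filter_upwards [eventually_gt_atTop 0] with s hs
  simp only [laplaceSymbol]
  rw [hJ.add α β hα hβ, ContinuousLinearMap.comp_apply, Real.rpow_add_one hs.ne',
    Real.rpow_add_one hs.ne', Real.rpow_add_one hs.ne', Real.rpow_add hs]
  ring

/-- Both operators multiply the transform of `f` by `s^(-α)` up to a negligible error, so uniqueness
identifies them. -/
theorem isRiemannLiouville (hJ : IsFractionalFamily a T J) {α : ℝ} (hα : 0 < α)
    (h : HasRLSymbol α (J α)) : IsRiemannLiouville a T α (J α) := by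
  intro f
  have hf := f.integrableOn
  have hrl := integrableOn_rlIntegral hα hf
  have h1 := expNegligible_laplaceOn_commutant hJ.lt hJ.one_apply (fun g => hJ.commute hα g) f
  have h2 := expNegligible_laplaceOn_rlIntegral_sub hJ.lt hα hf
  have hb : (fun s => s ^ (-α) * laplaceOn a T s f) =O[atTop] fun s => s ^ (-α) := by
    refine IsBigO.of_bound ‖f‖ ?_
    filter_upwards [eventually_ge_atTop 0] with s hs
    rw [norm_mul, mul_comm]
    gcongr
    exact abs_laplaceOn_le_norm hs _
  have h3 : ExpNegligible (T - a) fun s =>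
      laplaceOn a T s (fun x => J α f x - rlIntegral a α f x) := by
    refine ((h1.sub h2).add (ExpNegligible.mul_left h (-α) hb)).congr' ?_
    filter_upwards [eventually_gt_atTop 0] with s hs
    rw [laplaceOn_sub s (J α f).integrableOn hrl, laplaceSymbol, one_div, Real.inv_rpow hs.le,
      Real.rpow_neg hs.le, Real.rpow_add_one hs.ne']
    have := (Real.rpow_pos_of_pos hs α).ne'
    field_simp
    ring
  filter_upwards [ae_intervalIntegrable_rlIntegrand hα hf,
    ae_eq_zero_of_expNegligible_laplaceOn hJ.lt ((J α f).integrableOn.sub hrl) h3] with x hx1 hx2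
  exact ⟨hx1, sub_eq_zero.mp hx2⟩

theorem hasRLSymbol_one (hJ : IsFractionalFamily a T J) : HasRLSymbol 1 (J 1) := by
  refine HasRLSymbol.of_sub hJ.lt ?_
  have h := expNegligible_laplaceOn_rlIntegral_sub hJ.lt one_pos (oneL1 a T).integrableOn
  have h1 : (J 1 (oneL1 a T) : ℝ → ℝ) =ᵐ[volume.restrict (Ioo a T)]
      rlIntegral a 1 (oneL1 a T) := by
    filter_upwards [hJ.one_apply (oneL1 a T)] with x hx
    rw [hx, rlIntegral]
    simp [rlIntegrand]
  refine h.congr' (Eventually.of_forall fun s => ?_)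
  simp only
  rw [laplaceOn_congr s h1]

theorem laplaceSymbol_nat_mul (hJ : IsFractionalFamily a T J) {α : ℝ} (hα : 0 < α) (n : ℕ) :
    ExpNegligible (T - a) fun s =>
      laplaceSymbol ((n + 1 : ℕ) * α) (J ((n + 1 : ℕ) * α)) s -
        laplaceSymbol α (J α) s ^ (n + 1) := by
  induction n with
  | zero => exact fun r _ => by simpa using isBigO_zero _ _
  | succ n ih =>
    have h0 : 0 < ((n + 1 : ℕ) : ℝ) * α := by positivity
    have h1 := hJ.laplaceSymbol_add h0 hα
    refine (h1.add (ih.mul_left (α + 1) (laplaceSymbol_isBigO α (J α)))).congr'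
      (Eventually.of_forall fun s => ?_)
    have h2 : ((n + 1 + 1 : ℕ) : ℝ) * α = ((n + 1 : ℕ) : ℝ) * α + α := by push_cast; ring
    rw [h2]
    ring

theorem hasRLSymbol_nat (hJ : IsFractionalFamily a T J) (n : ℕ) :
    HasRLSymbol ((n + 1 : ℕ) : ℝ) (J ((n + 1 : ℕ) : ℝ)) := by
  have h := hJ.laplaceSymbol_nat_mul one_pos n
  rw [mul_one] at h
  refine (h.add (hJ.hasRLSymbol_one.pow_sub_one (sub_pos.mpr hJ.lt) (n + 1))).congr'
    (Eventually.of_forall fun s => ?_)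
  ring

/-- With `q = (m + 1) / (n + 1)`, the power `n + 1` of the symbol matches that of the integer order
`m + 1`; the order `q / 2` supplies the square that fixes the sign of the root. -/
theorem hasRLSymbol_rat (hJ : IsFractionalFamily a T J) {q : ℚ} (hq : 0 < q) :
    HasRLSymbol (q : ℝ) (J q) := by
  have hL : 0 < T - a := sub_pos.mpr hJ.lt
  have hq0 : (0 : ℝ) < q := by exact_mod_cast hq
  obtain ⟨m, hm⟩ : ∃ m : ℕ, q.num = (m + 1 : ℕ) := by
    have := Rat.num_pos.mpr hq
    exact ⟨(q.num - 1).toNat, by omega⟩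
  obtain ⟨n, hn⟩ := Nat.exists_eq_succ_of_ne_zero q.den_nz
  have hmul : ((n + 1 : ℕ) : ℝ) * (q : ℝ) = ((m + 1 : ℕ) : ℝ) := by
    have h1 : q * q.den = q.num := Rat.mul_den_eq_num q
    rw [hm, hn] at h1
    rw [mul_comm]
    exact_mod_cast h1
  have hpow := hJ.laplaceSymbol_nat_mul hq0 n
  rw [hmul] at hpow
  have hhalf := hJ.laplaceSymbol_add (half_pos hq0) (half_pos hq0)
  rw [add_halves] at hhalf
  refine ExpNegligible.sub_one_of_pow (Y := laplaceSymbol ((q : ℝ) / 2) (J ((q : ℝ) / 2)))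
    hL n.succ_ne_zero ?_ ?_
  · refine ((hJ.hasRLSymbol_nat m).sub hpow).congr' (Eventually.of_forall fun s => ?_)
    simp
  · exact hhalf.congr' (Eventually.of_forall fun s => by ring)

/-- Negligibility alone need not survive a pointwise limit, but an explicit bound independent of the
order does. It holds on `S`, which contains the positive rationals, and passes to `α`. -/
theorem hasRLSymbol_of_continuousWithinAt (hJ : IsFractionalFamily a T J) {α : ℝ} (hα : 0 < α)
    (hc : ContinuousWithinAt (fun β => J β (oneL1 a T)) (Ioi 0) α) : HasRLSymbol α (J α) := by
  set S : Set ℝ := {β | 0 < β ∧ HasRLSymbol β (J β)} with hS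
  have hcl : α ∈ closure S := by
    refine Metric.mem_closure_iff.mpr fun ε hε => ?_
    obtain ⟨q, hq1, hq2⟩ := exists_rat_btwn (lt_add_of_pos_right α hε)
    have hq0 : (0 : ℝ) < q := hα.trans hq1
    refine ⟨q, ⟨hq0, hJ.hasRLSymbol_rat (by exact_mod_cast hq0)⟩, ?_⟩
    rw [Real.dist_eq, abs_lt]
    constructor <;> linarith
  have := mem_closure_iff_nhdsWithin_neBot.mp hcl
  have hcS := hc.mono (fun β hβ => hβ.1 : S ⊆ Ioi 0)
  have hbound : ∀ s : ℝ, 1 ≤ s → |laplaceOn a T s (J α (oneL1 a T)) -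
      (1 / s) ^ α * laplaceOn a T s (oneL1 a T)| ≤
      Real.exp (-((s - 1) * (T - a))) * ∫ x in Ioo a T, |oneL1 a T x| := by
    intro s hs
    have hs0 : 0 < s := by linarith
    have h1 : Tendsto (fun β => |laplaceOn a T s (J β (oneL1 a T)) -
        (1 / s) ^ β * laplaceOn a T s (oneL1 a T)|) (𝓝[S] α)
        (𝓝 |laplaceOn a T s (J α (oneL1 a T)) - (1 / s) ^ α * laplaceOn a T s (oneL1 a T)|) := by
      refine (Tendsto.sub (((continuous_laplaceOn hs0.le).tendsto _).comp hcS) ?_).abs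
      refine Tendsto.mul_const _ ?_
      exact ((Real.continuous_const_rpow (by positivity)).tendsto α).mono_left
        nhdsWithin_le_nhds
    refine le_of_tendsto h1 ?_
    filter_upwards [self_mem_nhdsWithin] with β hβ
    have h2 : (J β (oneL1 a T) : ℝ → ℝ) =ᵐ[volume.restrict (Ioo a T)]
        rlIntegral a β (oneL1 a T) :=
      (hJ.isRiemannLiouville hβ.1 hβ.2 (oneL1 a T)).mono fun x hx => hx.2
    rw [laplaceOn_congr s h2]
    exact abs_laplaceOn_rlIntegral_sub_le hJ.lt hβ.1 hs (oneL1 a T).integrableOn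
  refine HasRLSymbol.of_sub hJ.lt fun r hr => ?_
  refine IsBigO.of_bound (Real.exp (T - a) * ∫ x in Ioo a T, |oneL1 a T x|) ?_
  filter_upwards [eventually_ge_atTop 1] with s hs
  rw [Real.norm_eq_abs, Real.norm_eq_abs, Real.abs_exp]
  refine (hbound s hs).trans ?_
  have h0 : 0 ≤ ∫ x in Ioo a T, |oneL1 a T x| := integral_nonneg fun x => abs_nonneg _
  rw [mul_right_comm, ← Real.exp_add]
  gcongr
  nlinarith

/-- For `β` near `α`, `J β 1` is the fixed operator `J (α - α₀)` applied to `J (β - (α - α₀)) 1`,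
whose order is near `α₀`. -/
theorem continuousWithinAt_of_lt (hJ : IsFractionalFamily a T J) {α₀ α : ℝ}
    (hc : ContinuousWithinAt (fun β => J β (oneL1 a T)) (Ioi 0) α₀) (h0 : 0 < α₀) (h : α₀ < α) :
    ContinuousWithinAt (fun β => J β (oneL1 a T)) (Ioi 0) α := by
  have hca : ContinuousAt (fun β => J β (oneL1 a T)) (α - (α - α₀)) := by
    rw [sub_sub_cancel]
    exact hc.continuousAt (Ioi_mem_nhds h0)
  have h1 : ContinuousAt (fun β => J (α - α₀) (J (β - (α - α₀)) (oneL1 a T))) α :=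
    (J (α - α₀)).continuous.continuousAt.comp
      (ContinuousAt.comp (f := fun β => β - (α - α₀)) hca (by fun_prop))
  refine (h1.congr ?_).continuousWithinAt
  filter_upwards [Ioi_mem_nhds (by linarith : α - α₀ < α)] with β hβ
  have h2 := hJ.add (α - α₀) (β - (α - α₀)) (sub_pos.mpr h) (sub_pos.mpr hβ)
  rw [add_sub_cancel] at h2
  rw [h2, ContinuousLinearMap.comp_apply]

/-- Orders above `α₀` are settled by continuity. For arbitrary `α`, the symbols of orders `α + (α₀ +
1)` and `α₀ + 1` are both `≈ 1`, and polynomial growth of the symbol of `J α` allows the second to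
be cancelled. -/
theorem hasRLSymbol (hJ : IsFractionalFamily a T J) {α₀ α : ℝ}
    (hc : ContinuousWithinAt (fun β => J β (oneL1 a T)) (Ioi 0) α₀) (h0 : 0 < α₀) (hα : 0 < α) :
    HasRLSymbol α (J α) := by
  have hgt : ∀ β, α₀ < β → HasRLSymbol β (J β) := fun β hβ =>
    hJ.hasRLSymbol_of_continuousWithinAt (h0.trans hβ) (hJ.continuousWithinAt_of_lt hc h0 hβ)
  have h1 := hgt (α₀ + 1) (by linarith)
  have h2 := hgt (α + (α₀ + 1)) (by linarith)
  have h3 := hJ.laplaceSymbol_add hα (by linarith : 0 < α₀ + 1)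
  refine ((ExpNegligible.sub h2 h3).sub
    (ExpNegligible.mul_left h1 (α + 1) (laplaceSymbol_isBigO α (J α)))).congr'
    (Eventually.of_forall fun s => ?_)
  ring

end IsFractionalFamily

end Family

theorem mainTheorem1 (a T : ℝ) (haT : a < T)
    -- only the values of `J` at orders `α > 0` play a role
    (J : ℝ → (L1On a T →L[ℝ] L1On a T))
    (hident : ∀ f : L1On a T, ∀ᵐ x ∂(volume.restrict (Ioo a T)), J 1 f x = ∫ t in a..x, f t)
    (hindex : ∀ α β : ℝ, 0 < α → 0 < β → J (α + β) = (J α).comp (J β)) :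
    -- continuity of `α ↦ J α 1` at one point suffices
    ((∃ α₀ : ℝ, 0 < α₀ ∧ ContinuousWithinAt (fun α => J α (oneL1 a T)) (Ioi 0) α₀) →
      ∀ α : ℝ, 0 < α → IsRiemannLiouville a T α (J α)) ∧
    -- that hypothesis is implied by norm continuity of the whole family on `(0, ∞)`
    (ContinuousOn J (Ioi 0) →
      ∃ α₀ : ℝ, 0 < α₀ ∧ ContinuousWithinAt (fun α => J α (oneL1 a T)) (Ioi 0) α₀) := by
  have hJ : IsFractionalFamily a T J := ⟨haT, hident, hindex⟩
  refine ⟨?_, fun h => ⟨1, one_pos, (h 1 (mem_Ioi.mpr one_pos)).clm_apply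
    continuousWithinAt_const⟩⟩
  rintro ⟨α₀, h0, hc⟩ α hα
  exact hJ.isRiemannLiouville hα (hJ.hasRLSymbol hc h0 hα)
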